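/- Let $\Omega$ be a finite state space with $|\Omega|=n$, identify $\Delta(\Omega)$ with the standard simplex in $\mathbb{R}^{\Omega}$, and let $p\in\Delta(\Omega)$ have full support. Let $A$ be a compact metric space, and let $u_S:A\to\mathbb{R}$ and $u_R(\omega,\cdot):A\to\mathbb{R}$ ($\omega\in\Omega$) be continuous. Let $\mathbf{V}(\mu)=\mathrm{co}\big(u_S(\arg\max_{a\in A}\sum_{\omega}\mu(\omega)u_R(\omega,a))\big)$, $\mu\in\Delta(\Omega)$, be the sender's indirect value correspondence. For a Borel probability measure $\tau$ on $\Delta(\Omega)$ and a measurable selection $U$ of $\mathbf{V}$ consider (BP) $\int\mu\,d\tau(\mu)=p$; (TT) $\int U(\mu)(\mu-p)\,d\tau(\mu)=0$; (CT) $U$ is constant on $\mathrm{supp}(\tau)$. Let $\mathcal{V}_{BP}(p)$ be the supremum of $\int \max\mathbf{V}(\mu)\,d\tau(\mu)$ over all $\tau$ satisfying (BP); let $\mathcal{V}_{MD}(p)$ be the supremum of $\int U\,d\tau$ over all $(U,\tau)$ satisfying (BP) and (TT); let $\mathcal{V}_{CT}(p)$ be the supremum of $\int U\,d\tau$ over all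 $(U,\tau)$ satisfying (BP) and (CT). Let $\mathcal{T}_{CT}(p)$ be the set of $\tau$ for which some $U$ makes (BP) and (CT) hold. We say that $\tau\in\mathcal{T}_{CT}(p)$ attains $s$ if $s\in\mathbf{V}(\mu)$ for all $\mu\in\mathrm{supp}(\tau)$. The full-dimensionality condition holds at $p$ if the union of the sets $\mathrm{aff}(\mathrm{supp}(\tau))\cap\Delta(\Omega)$, over all finitely supported $\tau\in\mathcal{T}_{CT}(p)$ that attain $\mathcal{V}_{CT}(p)$, equals $\Delta(\Omega)$. Let $k\ge 2$, let $T:\mathbb{R}^{\Omega}\to\mathbb{R}^k$ be linear and such that $X:=T(\Delta(\Omega))$ is $k$-dimensional (its affine hull is $\mathbb{R}^k$; in particular $k\le n-1$), and let $v:\mathbb{R}^k\to\mathbb{R}$ be continuous on $X$ and strictly quasiconvex on $X$, that is, $v(\lambda x+(1-\lambda)y)<\max\{v(x),v(y)\}$ for all $x\ne y$ in $X$ and $\lambda\in(0,1)$. Assume that $\mathbf{V}$ is singleton-valued with $\mathbf{V}(\mu)=\{V(\mu)\}$, $V(\mu)=v(T(\mu))$, for all $\mu\in\Delta(\Omega)$,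 and that the full-dimensionality condition holds at $p$. Then $\max V:=\max_{\mu\in\Delta(\Omega)}V(\mu)$ exists, and exactly one of the following two cases holds: (1) $\max V=\mathcal{V}_{BP}(p)=\mathcal{V}_{MD}(p)=\mathcal{V}_{CT}(p)>V(p)$; (2) $\max V>\mathcal{V}_{BP}(p)>\mathcal{V}_{MD}(p)>\mathcal{V}_{CT}(p)>V(p)$. -/

import Mathlib

noncomputable section

namespace Mediation

open MeasureTheory

/-- Beliefs over the finite state space `Ω`: the standard simplex, with its topology and Borel
`σ`-algebra as a subset of `Ω → ℝ`. -/
abbrev Belief (Ω : Type*) [Fintype Ω] : Type _ := stdSimplex ℝ Ω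

section Game

variable {Ω A : Type*} [Fintype Ω]

/-- The receiver's expected utility `E_μ[u_R(ω, a)]` from action `a` at belief `μ`. -/
def expectedUtility (uR : Ω → A → ℝ) (μ : Belief Ω) (a : A) : ℝ :=
  ∑ ω, μ.1 ω * uR ω a

/-- The receiver's best responses at belief `μ`. -/
def bestResponses (uR : Ω → A → ℝ) (μ : Belief Ω) : Set A :=
  {a | ∀ a', expectedUtility uR μ a' ≤ expectedUtility uR μ a}

/-- The sender's indirect value correspondence `μ ↦ co (u_S (argmax_a E_μ[u_R(ω, a)]))`. -/
def indirectValue (uS : A → ℝ) (uR : Ω → A → ℝ) (μ : Belief Ω) : Set ℝ :=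
  convexHull ℝ (uS '' bestResponses uR μ)

end Game

section Protocols

variable {Ω : Type*} [Fintype Ω]

/-- `U` is a measurable selection from the correspondence `VV`. -/
def IsSelection (VV : Belief Ω → Set ℝ) (U : Belief Ω → ℝ) : Prop :=
  Measurable U ∧ ∀ μ, U μ ∈ VV μ

/-- Bayes plausibility: the mean of the distribution of posteriors `τ` is the prior `p`. -/
def BayesPlausible (p : Belief Ω) (τ : ProbabilityMeasure (Belief Ω)) : Prop :=
  ∀ ω, ∫ μ, μ.1 ω ∂(τ : Measure (Belief Ω)) = p.1 ω

/-- Truth-telling: `∫ U(μ) (μ - p) dτ(μ) = 0`.  For Bayes-plausible `τ` this says that `U(μ)` and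
`μ` have zero covariance under `τ`. -/
def TruthTelling (p : Belief Ω) (U : Belief Ω → ℝ) (τ : ProbabilityMeasure (Belief Ω)) : Prop :=
  ∀ ω, ∫ μ, U μ * (μ.1 ω - p.1 ω) ∂(τ : Measure (Belief Ω)) = 0

/-- The (topological) support of a distribution of posteriors. -/
def supp (τ : ProbabilityMeasure (Belief Ω)) : Set (Belief Ω) :=
  (τ : Measure (Belief Ω)).support

/-- `U` is constant on the support of `τ`. -/
def ConstantOnSupp (U : Belief Ω → ℝ) (τ : ProbabilityMeasure (Belief Ω)) : Prop :=
  ∃ c : ℝ, ∀ μ ∈ supp τ, U μ = c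

/-- Optimal value under Bayesian persuasion: the supremum of the expectation of the upper envelope
`μ ↦ max VV(μ)` over all Bayes-plausible distributions of posteriors. -/
def valueBP (VV : Belief Ω → Set ℝ) (p : Belief Ω) : ℝ :=
  sSup {s | ∃ τ : ProbabilityMeasure (Belief Ω), BayesPlausible p τ ∧
    s = ∫ μ, sSup (VV μ) ∂(τ : Measure (Belief Ω))}

/-- Optimal value under mediation: the supremum of `∫ U dτ` over measurable selections `U` and
distributions of posteriors `τ` that satisfy Bayes plausibility and truth-telling. -/
def valueMD (VV : Belief Ω → Set ℝ) (p : Belief Ω) : ℝ :=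
  sSup {s | ∃ (U : Belief Ω → ℝ) (τ : ProbabilityMeasure (Belief Ω)), IsSelection VV U ∧
    BayesPlausible p τ ∧ TruthTelling p U τ ∧ s = ∫ μ, U μ ∂(τ : Measure (Belief Ω))}

/-- Optimal value under cheap talk: the supremum of `∫ U dτ` over measurable selections `U` and
Bayes-plausible distributions of posteriors `τ` such that `U` is constant on the support of `τ`. -/
def valueCT (VV : Belief Ω → Set ℝ) (p : Belief Ω) : ℝ :=
  sSup {s | ∃ (U : Belief Ω → ℝ) (τ : ProbabilityMeasure (Belief Ω)), IsSelection VV U ∧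
    BayesPlausible p τ ∧ ConstantOnSupp U τ ∧ s = ∫ μ, U μ ∂(τ : Measure (Belief Ω))}

/-- The distributions of posteriors implementable under cheap talk at the prior `p`. -/
def implementableCT (VV : Belief Ω → Set ℝ) (p : Belief Ω) :
    Set (ProbabilityMeasure (Belief Ω)) :=
  {τ | BayesPlausible p τ ∧ ∃ U, IsSelection VV U ∧ ConstantOnSupp U τ}

/-- The cheap talk hull of `s` at `p`: the union of the sets `aff (supp τ) ∩ Δ(Ω)` over the
finitely supported `τ`, implementable under cheap talk at `p`, that attain `s`, that is,
`s ∈ VV(μ)` for all `μ ∈ supp τ`. -/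
def cheapTalkHull (VV : Belief Ω → Set ℝ) (p : Belief Ω) (s : ℝ) : Set (Ω → ℝ) :=
  ⋃ τ ∈ {τ | τ ∈ implementableCT VV p ∧ (∀ μ ∈ supp τ, s ∈ VV μ) ∧ (supp τ).Finite},
    (affineSpan ℝ (Subtype.val '' supp τ) : Set (Ω → ℝ)) ∩ stdSimplex ℝ Ω

/-- The full-dimensionality condition at `p`: the cheap talk hull of the optimal cheap talk value
at `p` is the whole simplex. -/
def FullDimensional (VV : Belief Ω → Set ℝ) (p : Belief Ω) : Prop :=
  cheapTalkHull VV p (valueCT VV p) = stdSimplex ℝ Ω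

end Protocols

section Moments

variable {Ω : Type*} [Fintype Ω] {k : ℕ}

/-- The set `X = T(Δ(Ω))` of relevant moments. -/
def relevantMoments (T : (Ω → ℝ) →ₗ[ℝ] (Fin k → ℝ)) : Set (Fin k → ℝ) :=
  T '' stdSimplex ℝ Ω

/-- `T` restricts to a full-rank map on `Δ(Ω)`: its image `X = T(Δ(Ω))` is `k`-dimensional. -/
def IsMoment (T : (Ω → ℝ) →ₗ[ℝ] (Fin k → ℝ)) : Prop :=
  affineSpan ℝ (relevantMoments T) = ⊤

/-- Strict quasiconvexity on a (convex) set: `v(λx + (1 - λ)y) < max {v(x), v(y)}` for distinct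
`x, y` and `λ ∈ (0, 1)`. -/
def StrictQuasiconvexOn (X : Set (Fin k → ℝ)) (v : (Fin k → ℝ) → ℝ) : Prop :=
  ∀ ⦃x⦄, x ∈ X → ∀ ⦃y⦄, y ∈ X → x ≠ y → ∀ ⦃a b : ℝ⦄, 0 < a → 0 < b → a + b = 1 →
    v (a • x + b • y) < max (v x) (v y)

end Moments

end Mediation

end

noncomputable section

namespace Mediation

open MeasureTheory Set Filter Topology

/-! ### Moments of distributions of posteriors -/

section Moments

variable {Ω : Type*} [Fintype Ω]

/-! The triples (mean posterior, covariance of value and posterior, mean value) form a compact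
convex set, and persuasion and mediation maximize the last coordinate over slices of it. Let `c` be
the cheap talk value. Full dimensionality writes `p` as a mixture of any chosen posterior `q` and
posteriors of value `c`; hence from `(p, 0, c)` one can move in the direction `((V q - c)(q - p), V
q - c)`, and the feasible directions form a convex cone (`FullDimensional.exists_moments`,
`add_mem_feasibleDirections`).

Splitting off two opposite posteriors leaves residual means on either side of `p` with value at most
`c`, so strict quasiconvexity gives `V p < c` (`lt_valueCT`).

If `max V = c`, all the values coincide. If `max V > c`, then since `k ≥ 2` a chord through a point
of the level set `{V = c}` can be turned until both ends lie above `c`. Shifted towards `p` and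
combined with a point below `c`, they give a direction of zero covariance and positive gain, so
mediation beats cheap talk (`exists_profitable_deviation`, `exists_mediation_gain`). The value is
then not almost surely constant under an optimal mediation policy, and reweighting by a density
increasing in value preserves the mean and raises the payoff by a multiple of the variance
(`exists_improvement`). Finally, if persuasion reached `max V`, its value would be almost surely
constant, so cheap talk would reach it too. -/

theorem continuous_belief_apply (ω : Ω) : Continuous fun μ : Belief Ω => μ.1 ω :=
  (continuous_apply ω).comp continuous_subtype_val

theorem integrable_of_continuous {f : Belief Ω → ℝ} (hf : Continuous f)
    (τ : ProbabilityMeasure (Belief Ω)) : Integrable f (τ : Measure (Belief Ω)) :=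
  hf.integrable_of_hasCompactSupport (HasCompactSupport.of_compactSpace f)

theorem continuous_integral {f : Belief Ω → ℝ} (hf : Continuous f) :
    Continuous fun τ : ProbabilityMeasure (Belief Ω) => ∫ μ, f μ ∂(τ : Measure (Belief Ω)) := by
  rw [continuous_iff_continuousAt]
  intro τ
  exact ProbabilityMeasure.tendsto_iff_forall_integral_tendsto.1 tendsto_id
    (BoundedContinuousFunction.mkOfCompact ⟨f, hf⟩)

theorem exists_mixture (τ₁ τ₂ : ProbabilityMeasure (Belief Ω)) {a b : ℝ} (ha : 0 ≤ a) (hb : 0 ≤ b)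
    (hab : a + b = 1) : ∃ τ : ProbabilityMeasure (Belief Ω), ∀ f : Belief Ω → ℝ, Continuous f →
      ∫ μ, f μ ∂(τ : Measure (Belief Ω)) = a * ∫ μ, f μ ∂(τ₁ : Measure (Belief Ω)) +
        b * ∫ μ, f μ ∂(τ₂ : Measure (Belief Ω)) := by
  refine ⟨⟨ENNReal.ofReal a • (τ₁ : Measure (Belief Ω)) +
    ENNReal.ofReal b • (τ₂ : Measure (Belief Ω)), ⟨?_⟩⟩, fun f hf => ?_⟩
  · simp [← ENNReal.ofReal_add ha hb, hab]
  · have h₁ := integrable_of_continuous hf τ₁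
    have h₂ := integrable_of_continuous hf τ₂
    simp only [ProbabilityMeasure.coe_mk]
    rw [integral_add_measure (h₁.smul_measure ENNReal.ofReal_ne_top)
      (h₂.smul_measure ENNReal.ofReal_ne_top), integral_smul_measure, integral_smul_measure,
      ENNReal.toReal_ofReal ha, ENNReal.toReal_ofReal hb, smul_eq_mul, smul_eq_mul]

/-- Absolute continuity is recorded so that a value that is almost surely constant under `τ` stays
so under `τ'`. -/
theorem exists_reweighting (τ : ProbabilityMeasure (Belief Ω)) {g : Belief Ω → ℝ}
    (hg : Measurable g) (hg0 : ∀ μ, 0 ≤ g μ) (hgi : Integrable g (τ : Measure (Belief Ω)))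
    (hg1 : ∫ μ, g μ ∂(τ : Measure (Belief Ω)) = 1) :
    ∃ τ' : ProbabilityMeasure (Belief Ω), (τ' : Measure (Belief Ω)) ≪ τ ∧ ∀ f : Belief Ω → ℝ,
      ∫ μ, f μ ∂(τ' : Measure (Belief Ω)) = ∫ μ, g μ * f μ ∂(τ : Measure (Belief Ω)) := by
  refine ⟨⟨(τ : Measure (Belief Ω)).withDensity fun μ => ENNReal.ofReal (g μ), ⟨?_⟩⟩,
    withDensity_absolutelyContinuous _ _, fun f => ?_⟩
  · rw [withDensity_apply _ MeasurableSet.univ, Measure.restrict_univ,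
      ← ofReal_integral_eq_lintegral_ofReal hgi (ae_of_all _ hg0), hg1, ENNReal.ofReal_one]
  · simp only [ProbabilityMeasure.coe_mk]
    rw [integral_withDensity_eq_integral_toReal_smul hg.ennreal_ofReal (by simp)]
    simp [ENNReal.toReal_ofReal (hg0 _)]

/-- The moments of a distribution of posteriors that enter the mediation problem: the mean
posterior, the covariance of value and posterior, and the mean value. -/
def moments (W : Belief Ω → ℝ) (p : Belief Ω) (τ : ProbabilityMeasure (Belief Ω)) :
    (Ω → ℝ) × (Ω → ℝ) × ℝ :=
  (fun ω => ∫ μ, μ.1 ω ∂(τ : Measure (Belief Ω)),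
    fun ω => ∫ μ, W μ * (μ.1 ω - p.1 ω) ∂(τ : Measure (Belief Ω)),
    ∫ μ, W μ ∂(τ : Measure (Belief Ω)))

variable {W : Belief Ω → ℝ}

theorem continuous_covariance_term (hW : Continuous W) (p : Belief Ω) (ω : Ω) :
    Continuous fun μ : Belief Ω => W μ * (μ.1 ω - p.1 ω) :=
  hW.mul ((continuous_belief_apply ω).sub continuous_const)

/-- Probability measures on the compact simplex are weakly compact, and each moment integrates a
continuous function. -/
theorem isCompact_range_moments (hW : Continuous W) (p : Belief Ω) :
    IsCompact (range (moments W p)) := by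
  refine isCompact_range ?_
  exact (continuous_pi fun ω => continuous_integral (continuous_belief_apply ω)).prodMk
    ((continuous_pi fun ω => continuous_integral (continuous_covariance_term hW p ω)).prodMk
      (continuous_integral hW))

theorem convex_range_moments (hW : Continuous W) (p : Belief Ω) :
    Convex ℝ (range (moments W p)) := by
  rintro _ ⟨τ₁, rfl⟩ _ ⟨τ₂, rfl⟩ a b ha hb hab
  obtain ⟨τ, hτ⟩ := exists_mixture τ₁ τ₂ ha hb hab
  refine ⟨τ, ?_⟩
  refine Prod.ext (funext fun ω => ?_) (Prod.ext (funext fun ω => ?_) ?_)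
  · simp [moments, hτ _ (continuous_belief_apply ω)]
  · simp [moments, hτ _ (continuous_covariance_term hW p ω)]
  · simp [moments, hτ _ hW]

theorem moments_mem_range (W : Belief Ω → ℝ) (p q : Belief Ω) :
    (q.1, W q • (q.1 - p.1), W q) ∈ range (moments W p) := by
  refine ⟨⟨Measure.dirac q, inferInstance⟩, ?_⟩
  simp only [moments, ProbabilityMeasure.coe_mk, integral_dirac]
  rfl

theorem ae_mem_supp (τ : ProbabilityMeasure (Belief Ω)) :
    ∀ᵐ μ ∂(τ : Measure (Belief Ω)), μ ∈ supp τ :=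
  Measure.support_mem_ae

theorem eqOn_supp_of_ae (hW : Continuous W) {τ : ProbabilityMeasure (Belief Ω)} {c : ℝ}
    (h : ∀ᵐ μ ∂(τ : Measure (Belief Ω)), W μ = c) : ∀ μ ∈ supp τ, W μ = c := by
  intro μ hμ
  exact Measure.support_subset_of_isClosed (isClosed_eq hW continuous_const) h hμ

theorem singleton_pos_of_mem_supp {τ : ProbabilityMeasure (Belief Ω)} (hfin : (supp τ).Finite)
    {x : Belief Ω} (hx : x ∈ supp τ) : 0 < (τ : Measure (Belief Ω)).real {x} := by
  rw [measureReal_def, ENNReal.toReal_pos_iff]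
  refine ⟨?_, measure_lt_top _ _⟩
  -- Finiteness isolates `x` within the support, so this neighbourhood has the mass of `{x}` alone.
  have hU : (supp τ \ {x})ᶜ ∈ 𝓝 x :=
    (hfin.subset sdiff_subset).isClosed.isOpen_compl.mem_nhds (by simp)
  have h := (Measure.mem_support_iff_forall x).1 hx _ hU
  refine h.trans_le (measure_mono_ae ?_)
  filter_upwards [ae_mem_supp τ] with μ hμ hμ'
  by_contra hne
  exact hμ' ⟨hμ, hne⟩

theorem integral_indicator_singleton_mul (τ : ProbabilityMeasure (Belief Ω)) (x : Belief Ω)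
    (f : Belief Ω → ℝ) :
    ∫ μ, ({x} : Set (Belief Ω)).indicator (fun _ => (1 : ℝ)) μ * f μ ∂(τ : Measure (Belief Ω)) =
      (τ : Measure (Belief Ω)).real {x} * f x := by
  have : (fun μ => ({x} : Set (Belief Ω)).indicator (fun _ => (1 : ℝ)) μ * f μ) =
      ({x} : Set (Belief Ω)).indicator fun _ => f x := by
    funext μ
    by_cases h : μ = x <;> simp [h]
  rw [this, integral_indicator (MeasurableSet.singleton x), setIntegral_const, smul_eq_mul]

/-- If `q` lies in the affine span of the support of a finitely supported `τ`, then some multiple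
of the Dirac mass at `q` can be split off from the mean of `τ`. -/
theorem exists_split_of_mem_affineSpan {τ : ProbabilityMeasure (Belief Ω)}
    (hfin : (supp τ).Finite) {p q : Belief Ω} (hp : BayesPlausible p τ)
    (hq : q.1 ∈ affineSpan ℝ (Subtype.val '' supp τ)) :
    ∃ ε : ℝ, 0 < ε ∧ ε < 1 ∧ ∃ τ' : ProbabilityMeasure (Belief Ω),
      (τ' : Measure (Belief Ω)) ≪ τ ∧
      ∀ ω, p.1 ω = ε * q.1 ω + (1 - ε) * ∫ μ, μ.1 ω ∂(τ' : Measure (Belief Ω)) := by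
  classical
  obtain ⟨F, a, hF, ha, hqa⟩ := eq_affineCombination_of_mem_affineSpan_image hq
  rw [F.affineCombination_eq_linear_combination _ _ ha] at hqa
  set m : Belief Ω → ℝ := fun x => (τ : Measure (Belief Ω)).real {x} with hm
  have hmpos : ∀ x ∈ F, 0 < m x := fun x hx => singleton_pos_of_mem_supp hfin (hF hx)
  -- Density with respect to `τ` of the signed measure `∑ a x • δ_x`, whose mean is `q`.
  set d : Belief Ω → ℝ := fun μ => ∑ x ∈ F, a x / m x *
    ({x} : Set (Belief Ω)).indicator (fun _ => (1 : ℝ)) μ with hd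
  set R : ℝ := ∑ x ∈ F, |a x / m x| with hR
  have hR0 : 0 ≤ R := Finset.sum_nonneg fun _ _ => abs_nonneg _
  have hdR : ∀ μ, d μ ≤ R := fun μ => Finset.sum_le_sum fun x _ => by
    by_cases h : μ = x
    · simpa [h] using le_abs_self _
    · simp [h]
  have hind : ∀ (f : Belief Ω → ℝ), Continuous f → ∀ x : Belief Ω,
      Integrable (fun μ => a x / m x *
        (({x} : Set (Belief Ω)).indicator (fun _ => (1 : ℝ)) μ * f μ))
        (τ : Measure (Belief Ω)) := fun f hf x => by
    refine Integrable.const_mul ?_ _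
    have h := (integrable_of_continuous hf τ).indicator (MeasurableSet.singleton x)
    refine h.congr (ae_of_all _ fun μ => ?_)
    by_cases h : μ = x <;> simp [h]
  have hdf : ∀ (f : Belief Ω → ℝ) μ, d μ * f μ = ∑ x ∈ F, a x / m x *
      (({x} : Set (Belief Ω)).indicator (fun _ => (1 : ℝ)) μ * f μ) := fun f μ => by
    simp only [hd, Finset.sum_mul, mul_assoc]
  have hdi : ∀ f : Belief Ω → ℝ, Continuous f →
      Integrable (fun μ => d μ * f μ) (τ : Measure (Belief Ω)) := fun f hf => by
    simp only [hdf f]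
    exact integrable_finsetSum _ fun x _ => hind f hf x
  have hdint : ∀ f : Belief Ω → ℝ, Continuous f →
      ∫ μ, d μ * f μ ∂(τ : Measure (Belief Ω)) = ∑ x ∈ F, a x * f x := fun f hf => by
    simp only [hdf f]
    rw [integral_finsetSum _ fun x _ => hind f hf x]
    refine Finset.sum_congr rfl fun x hx => ?_
    rw [integral_const_mul, integral_indicator_singleton_mul, ← mul_assoc,
      div_mul_cancel₀ _ (hmpos x hx).ne']
  -- Small enough that `ε * d ≤ 1`; the `2` makes `ε < 1` even when `R = 0`.
  set ε : ℝ := 1 / (2 + R) with hε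
  have hεpos : 0 < ε := by positivity
  have hεlt : ε < 1 := by rw [hε, div_lt_one (by positivity)]; linarith
  have h1ε : 0 < 1 - ε := by linarith
  have hεR : ε * R ≤ 1 := by
    rw [hε, div_mul_eq_mul_div, one_mul, div_le_one (by positivity)]; linarith
  set g : Belief Ω → ℝ := fun μ => (1 - ε)⁻¹ * (1 - ε * d μ) with hg
  have hgf : ∀ f : Belief Ω → ℝ, Continuous f →
      ∫ μ, g μ * f μ ∂(τ : Measure (Belief Ω)) =
        (1 - ε)⁻¹ * (∫ μ, f μ ∂(τ : Measure (Belief Ω)) - ε * ∑ x ∈ F, a x * f x) :=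
    fun f hf => by
      have : ∀ μ, g μ * f μ = (1 - ε)⁻¹ * (f μ - ε * (d μ * f μ)) := fun μ => by
        simp only [hg]; ring
      simp only [this]
      rw [integral_const_mul, integral_sub (integrable_of_continuous hf τ)
        ((hdi f hf).const_mul ε), integral_const_mul, hdint f hf]
  have hdm : Measurable d := by
    refine Finset.measurable_sum _ fun x _ => Measurable.const_mul ?_ _
    exact measurable_const.indicator (MeasurableSet.singleton x)
  have hdi1 : Integrable d (τ : Measure (Belief Ω)) := by
    simpa using hdi (fun _ => 1) continuous_const
  obtain ⟨τ', hac, hτ'⟩ := exists_reweighting τ (g := g)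
    ((measurable_const.sub (hdm.const_mul ε)).const_mul _)
    (fun μ => mul_nonneg (inv_nonneg.2 h1ε.le)
      (by have := mul_le_mul_of_nonneg_left (hdR μ) hεpos.le; linarith))
    (((integrable_const 1).sub (hdi1.const_mul ε)).const_mul _)
    (by
      have := hgf (fun _ => 1) continuous_const
      simp only [mul_one, ha, integral_const, probReal_univ, smul_eq_mul] at this
      rw [this, inv_mul_cancel₀ h1ε.ne'])
  refine ⟨ε, hεpos, hεlt, τ', hac, fun ω => ?_⟩
  rw [hτ', hgf _ (continuous_belief_apply ω), hp ω, ← mul_assoc, mul_inv_cancel₀ h1ε.ne', hqa]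
  simp

end Moments

/-! ### Strict quasiconvexity and chords of the moment set -/

section Geometry

variable {Ω : Type*} [Fintype Ω] {k : ℕ}

/-- A line, or a point if `w = 0`, cannot contain a set whose affine hull has dimension `k ≥ 2`. -/
theorem exists_moment_notMem_span (hk : 2 ≤ k) {T : (Ω → ℝ) →ₗ[ℝ] (Fin k → ℝ)} (hT : IsMoment T)
    (x w : Fin k → ℝ) : ∃ m ∈ stdSimplex ℝ Ω, T m - x ∉ Submodule.span ℝ {w} := by
  by_contra! h
  have hle : affineSpan ℝ (relevantMoments T) ≤ AffineSubspace.mk' x (Submodule.span ℝ {w}) := by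
    rw [affineSpan_le]
    rintro _ ⟨m, hm, rfl⟩
    exact AffineSubspace.mem_mk'.2 (h m hm)
  rw [hT, top_le_iff] at hle
  have hd : Submodule.span ℝ {w} = ⊤ := by
    rw [← AffineSubspace.direction_mk' x (Submodule.span ℝ {w}), hle, AffineSubspace.direction_top]
  have h₁ := finrank_span_le_card (R := ℝ) ({w} : Set (Fin k → ℝ))
  rw [hd, finrank_top, Module.finrank_fin_fun] at h₁
  simp at h₁
  omega

theorem exists_radius {q : Ω → ℝ} (hq : q ∈ stdSimplex ℝ Ω) (hpos : ∀ ω, 0 < q ω) :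
    ∃ δ > 0, ∀ e : Ω → ℝ, ∑ ω, e ω = 0 → ‖e‖ ≤ δ → q + e ∈ stdSimplex ℝ Ω := by
  obtain ⟨δ, hδ, hδq⟩ : ∃ δ > 0, ∀ ω, δ ≤ q ω := by
    rcases isEmpty_or_nonempty Ω with h | h
    · exact ⟨1, one_pos, fun ω => (h.false ω).elim⟩
    · obtain ⟨i, hi⟩ := Finite.exists_min q
      exact ⟨q i, hpos i, hi⟩
  refine ⟨δ, hδ, fun e he hn => ⟨fun ω => ?_, ?_⟩⟩
  · have h₁ := (norm_le_pi_norm e ω).trans hn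
    have h₂ := neg_abs_le (e ω)
    rw [Real.norm_eq_abs] at h₁
    have := hδq ω
    simp only [Pi.add_apply]
    linarith
  · simp only [Pi.add_apply, Finset.sum_add_distrib, he, hq.2, add_zero]

variable {T : (Ω → ℝ) →ₗ[ℝ] (Fin k → ℝ)} {v : (Fin k → ℝ) → ℝ}

theorem continuousOn_comp_moment (hvc : ContinuousOn v (relevantMoments T)) :
    ContinuousOn (fun x => v (T x)) (stdSimplex ℝ Ω) :=
  hvc.comp (LinearMap.continuous_of_finiteDimensional T).continuousOn fun x hx => ⟨x, hx, rfl⟩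

theorem StrictQuasiconvexOn.comp_lt (hvq : StrictQuasiconvexOn (relevantMoments T) v)
    {x y : Ω → ℝ} (hx : x ∈ stdSimplex ℝ Ω) (hy : y ∈ stdSimplex ℝ Ω) (hxy : T x ≠ T y) {a b : ℝ}
    (ha : 0 < a) (hb : 0 < b) (hab : a + b = 1) :
    v (T (a • x + b • y)) < max (v (T x)) (v (T y)) := by
  rw [map_add, map_smul, map_smul]
  exact hvq ⟨x, hx, rfl⟩ ⟨y, hy, rfl⟩ hxy ha hb hab

/-- `T` may identify distinct beliefs, where strict quasiconvexity is silent; there the value is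
constant along the segment. -/
theorem StrictQuasiconvexOn.convex_sublevel (hvq : StrictQuasiconvexOn (relevantMoments T) v)
    (c : ℝ) : Convex ℝ {x ∈ stdSimplex ℝ Ω | v (T x) ≤ c} := by
  rintro x ⟨hx, hxc⟩ y ⟨hy, hyc⟩ a b ha hb hab
  refine ⟨convex_stdSimplex ℝ Ω hx hy ha hb hab, ?_⟩
  by_cases hxy : T x = T y
  · rw [map_add, map_smul, map_smul, hxy, ← add_smul, hab, one_smul]
    exact hyc
  rcases ha.eq_or_lt with rfl | ha
  · obtain rfl : b = 1 := by linarith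
    simpa using hyc
  rcases hb.eq_or_lt with rfl | hb
  · obtain rfl : a = 1 := by linarith
    simpa using hxc
  exact (hvq.comp_lt hx hy hxy ha hb hab).le.trans (max_le hxc hyc)

/-- In dimension at least two, there is a chord through a point `q` of the level set `{v = c}` both
of whose nearby endpoints have a value above `c`. -/
theorem exists_chord_above (hk : 2 ≤ k) (hT : IsMoment T)
    (hvc : ContinuousOn v (relevantMoments T)) (hvq : StrictQuasiconvexOn (relevantMoments T) v)
    {p q : Ω → ℝ} (hp : p ∈ stdSimplex ℝ Ω) (hq : q ∈ stdSimplex ℝ Ω)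
    (hpq : v (T p) < v (T q)) {δ : ℝ} (hδ : 0 < δ)
    (hball : ∀ e : Ω → ℝ, ∑ ω, e ω = 0 → ‖e‖ ≤ δ → q + e ∈ stdSimplex ℝ Ω) :
    ∃ h : Ω → ℝ, ∑ ω, h ω = 0 ∧ ‖h‖ ≤ δ ∧ v (T q) < v (T (q + h)) ∧ v (T q) < v (T (q - h)) := by
  obtain ⟨m, hm, hmT⟩ := exists_moment_notMem_span hk hT (T p) (T (p - q))
  set d₁ := p - q with hd₁
  set d₂ := m - p with hd₂
  have hs₁ : ∑ ω, d₁ ω = 0 := by simp [hd₁, hp.2, hq.2]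
  have hs₂ : ∑ ω, d₂ ω = 0 := by simp [hd₂, hp.2, hm.2]
  rw [← map_sub] at hmT
  have hTd₁ : T d₁ ≠ 0 := fun h => by
    rw [hd₁, map_sub, sub_eq_zero] at h
    rw [h] at hpq
    exact lt_irrefl _ hpq
  -- The bound `1 / 2` keeps `q + r • d₁` strictly between `q` and `p`; the other bound keeps the
  -- path within radius `δ`.
  set r : ℝ := min (1 / 2) (δ / (‖d₁‖ + ‖d₂‖ + 1)) with hr
  have hr0 : 0 < r := by positivity
  have hr1 : r ≤ 1 / 2 := min_le_left _ _
  have hrδ : r * (‖d₁‖ + ‖d₂‖ + 1) ≤ δ := by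
    rw [← le_div_iff₀ (by positivity)]; exact min_le_right _ _
  -- A path from `r • d₁` to its negative; the `d₂` term makes it avoid the kernel of `T`, because
  -- `T d₂` is not a multiple of `T d₁`.
  set h : ℝ → Ω → ℝ := fun s => r • ((1 - 2 * s) • d₁ + (s * (1 - s)) • d₂) with hh
  have hsum : ∀ s, ∑ ω, h s ω = 0 := fun s => by
    simp only [hh, Pi.smul_apply, Pi.add_apply, smul_eq_mul, ← Finset.mul_sum,
      Finset.sum_add_distrib, hs₁, hs₂, mul_zero, add_zero]
  have hnorm : ∀ s ∈ Icc (0 : ℝ) 1, ‖h s‖ ≤ δ := fun s hs => by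
    refine le_trans ?_ hrδ
    rw [hh, norm_smul, Real.norm_of_nonneg hr0.le]
    refine mul_le_mul_of_nonneg_left ?_ hr0.le
    have e₁ : ‖(1 - 2 * s) • d₁‖ ≤ ‖d₁‖ := by
      rw [norm_smul]
      refine mul_le_of_le_one_left (norm_nonneg _) ?_
      rw [Real.norm_eq_abs, abs_le]; constructor <;> linarith [hs.1, hs.2]
    have e₂ : ‖(s * (1 - s)) • d₂‖ ≤ ‖d₂‖ := by
      rw [norm_smul]
      refine mul_le_of_le_one_left (norm_nonneg _) ?_
      rw [Real.norm_eq_abs, abs_le]; constructor <;> nlinarith [hs.1, hs.2]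
    linarith [norm_add_le ((1 - 2 * s) • d₁) ((s * (1 - s)) • d₂)]
  have hTh : ∀ s ∈ Icc (0 : ℝ) 1, T (h s) ≠ 0 := fun s hs h0 => by
    simp only [hh, map_smul, map_add, smul_eq_zero, hr0.ne', false_or] at h0
    by_cases hs0 : s * (1 - s) = 0
    · rw [hs0, zero_smul, add_zero, smul_eq_zero] at h0
      rcases h0 with h0 | h0
      · nlinarith
      · exact hTd₁ h0
    · refine hmT (Submodule.mem_span_singleton.2 ⟨-((1 - 2 * s) / (s * (1 - s))), ?_⟩)
      have := congrArg (fun z => (s * (1 - s))⁻¹ • z) (eq_neg_of_add_eq_zero_right h0)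
      simp only [smul_smul, inv_mul_cancel₀ hs0, one_smul, smul_neg] at this
      rw [this, neg_smul, div_eq_inv_mul]
  have hmemp : ∀ s ∈ Icc (0 : ℝ) 1, q + h s ∈ stdSimplex ℝ Ω := fun s hs =>
    hball _ (hsum s) (hnorm s hs)
  have hmemm : ∀ s ∈ Icc (0 : ℝ) 1, q - h s ∈ stdSimplex ℝ Ω := fun s hs => by
    rw [sub_eq_add_neg]
    exact hball _ (by simp [hsum s]) (by simpa using hnorm s hs)
  have hmax : ∀ s ∈ Icc (0 : ℝ) 1, v (T q) < max (v (T (q + h s))) (v (T (q - h s))) :=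
    fun s hs => by
      have hne : T (q + h s) ≠ T (q - h s) := fun he => by
        refine hTh s hs ?_
        rw [map_add, map_sub, sub_eq_add_neg, add_right_inj, eq_neg_iff_add_eq_zero,
          ← two_smul ℝ, smul_eq_zero] at he
        exact he.resolve_left two_ne_zero
      have := hvq.comp_lt (hmemp s hs) (hmemm s hs) hne (a := 1 / 2) (b := 1 / 2) (by norm_num)
        (by norm_num) (by norm_num)
      have heq : (1 / 2 : ℝ) • (q + h s) + (1 / 2 : ℝ) • (q - h s) = q := by module
      rwa [heq] at this
  have hhc : Continuous h := by fun_prop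
  have hcp : ContinuousOn (fun s => v (T (q + h s))) (Icc 0 1) :=
    (continuousOn_comp_moment hvc).comp (continuous_const.add hhc).continuousOn hmemp
  have hcm : ContinuousOn (fun s => v (T (q - h s))) (Icc 0 1) :=
    (continuousOn_comp_moment hvc).comp (continuous_const.sub hhc).continuousOn hmemm
  have h0 : h 0 = r • d₁ := by simp [hh]
  have h1 : h 1 = -(r • d₁) := by simp only [hh]; module
  have hlow : v (T (q + r • d₁)) < v (T q) := by
    have hne : T p ≠ T q := fun he => by rw [he] at hpq; exact lt_irrefl _ hpq
    have := hvq.comp_lt hp hq hne hr0 (b := 1 - r) (by linarith) (by ring)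
    have heq : r • p + (1 - r) • q = q + r • d₁ := by simp only [hd₁]; module
    rwa [heq, max_eq_right hpq.le] at this
  have hhigh : v (T q) < v (T (q - r • d₁)) := by
    have := hmax 0 (by simp)
    rw [h0] at this
    exact (lt_max_iff.1 this).resolve_left hlow.not_gt
  -- The chord's ends swap between `s = 0` and `s = 1`, so their values agree at some `s`; by `hmax`
  -- the common value exceeds that of the midpoint `q`.
  have hivt := intermediate_value_Icc (zero_le_one' ℝ) (hcp.sub hcm)
  obtain ⟨s, hs, hsv⟩ : (0 : ℝ) ∈ (fun s => v (T (q + h s)) - v (T (q - h s))) '' Icc 0 1 := by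
    refine hivt ⟨?_, ?_⟩
    · simp only [Pi.sub_apply, h0]; linarith
    · simp only [Pi.sub_apply, h1, ← sub_eq_add_neg, sub_neg_eq_add]; linarith
  have heq : v (T (q + h s)) = v (T (q - h s)) := sub_eq_zero.1 hsv
  have := hmax s hs
  rw [← heq, max_self] at this
  exact ⟨h s, hsum s, hnorm s hs, this, heq ▸ this⟩

/-- There are two points with a value above `c` and one with a value below `c` whose signed,
weighted deviations from `p` cancel out, with a positive net gain. -/
theorem exists_profitable_deviation (hk : 2 ≤ k) (hT : IsMoment T)
    (hvc : ContinuousOn v (relevantMoments T)) (hvq : StrictQuasiconvexOn (relevantMoments T) v)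
    {p m : Ω → ℝ} (hp : p ∈ stdSimplex ℝ Ω) (hpos : ∀ ω, 0 < p ω) (hm : m ∈ stdSimplex ℝ Ω) {c : ℝ}
    (hpc : v (T p) < c) (hmc : c < v (T m)) :
    ∃ x₁ ∈ stdSimplex ℝ Ω, ∃ x₂ ∈ stdSimplex ℝ Ω, ∃ y ∈ stdSimplex ℝ Ω, ∃ A B : ℝ, 0 < A ∧ 0 < B ∧
      B < A ∧ c < v (T x₁) ∧ c < v (T x₂) ∧ v (T y) < c ∧
      (A / 2) • (x₁ - p) + (A / 2) • (x₂ - p) = B • (y - p) := by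
  set f : ℝ → Ω → ℝ := fun t => p + t • (m - p) with hf
  have hfmem : ∀ t ∈ Icc (0 : ℝ) 1, f t ∈ stdSimplex ℝ Ω := fun t ht =>
    (convex_stdSimplex ℝ Ω).add_smul_sub_mem hp hm ht
  have hfc : Continuous f := by fun_prop
  have hc : ContinuousOn (fun t => v (T (f t))) (Icc 0 1) :=
    (continuousOn_comp_moment hvc).comp hfc.continuousOn hfmem
  obtain ⟨t, ht, htc⟩ := intermediate_value_Icc (zero_le_one' ℝ) hc
    (show c ∈ Icc _ _ from ⟨by simpa [hf] using hpc.le, by simpa [hf] using hmc.le⟩)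
  have ht1 : t < 1 := lt_of_le_of_ne ht.2 fun h => by
    subst h; simp only [hf, one_smul, add_sub_cancel] at htc; exact hmc.ne' htc
  set q := f t with hq
  replace htc : v (T q) = c := htc
  have hqmem : q ∈ stdSimplex ℝ Ω := hfmem t ht
  have hqpos : ∀ ω, 0 < q ω := fun ω => by
    have h₁ := mul_pos (sub_pos.2 ht1) (hpos ω)
    have h₂ := mul_nonneg ht.1 (hm.1 ω)
    simp only [hq, hf, Pi.add_apply, Pi.smul_apply, Pi.sub_apply, smul_eq_mul]
    linarith
  obtain ⟨δ, hδ, hball⟩ := exists_radius hqmem hqpos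
  -- Half the radius leaves room to shift the chord towards `p`.
  obtain ⟨h, hsum, hnorm, hplus, hminus⟩ := exists_chord_above hk hT hvc hvq hp hqmem
    (htc.symm ▸ hpc) (half_pos hδ) fun e he hn => hball e he (by linarith)
  rw [htc] at hplus hminus
  have hdsum : ∑ ω, (p - q) ω = 0 := by simp [hp.2, hqmem.2]
  have key : ∀ e : Ω → ℝ, ∑ ω, e ω = 0 → ‖e‖ ≤ δ / 2 → c < v (T (q + e)) →
      ∀ᶠ s in 𝓝[>] (0 : ℝ), q + e + s • (p - q) ∈ stdSimplex ℝ Ω ∧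
        c < v (T (q + e + s • (p - q))) := by
    intro e he hn hce
    have hgc : Continuous fun s : ℝ => q + e + s • (p - q) := by fun_prop
    have hmem : ∀ᶠ s in 𝓝[>] (0 : ℝ), q + e + s • (p - q) ∈ stdSimplex ℝ Ω := by
      have hnc : Continuous fun s : ℝ => ‖e + s • (p - q)‖ := by fun_prop
      have : ∀ᶠ s in 𝓝 (0 : ℝ), ‖e + s • (p - q)‖ < δ :=
        hnc.continuousAt.eventually_lt continuousAt_const (by simp; linarith)
      filter_upwards [this.filter_mono nhdsWithin_le_nhds] with s hs
      rw [add_assoc]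
      refine hball _ ?_ hs.le
      simp only [Pi.add_apply, Pi.smul_apply, smul_eq_mul, Finset.sum_add_distrib,
        ← Finset.mul_sum, he, hdsum, mul_zero, add_zero]
    have hlim : Tendsto (fun s : ℝ => q + e + s • (p - q)) (𝓝[>] 0)
        (𝓝[stdSimplex ℝ Ω] (q + e)) := by
      refine tendsto_nhdsWithin_iff.2 ⟨?_, hmem⟩
      have := hgc.tendsto 0
      simp only [zero_smul, add_zero] at this
      exact this.mono_left nhdsWithin_le_nhds
    have hqe : q + e ∈ stdSimplex ℝ Ω := hball e he (by linarith)
    have := ((continuousOn_comp_moment hvc) _ hqe).tendsto.comp hlim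
    exact hmem.and (this.eventually (lt_mem_nhds hce))
  have key₂ := key (-h) (by simp [hsum]) (by simpa using hnorm)
    (by simpa [← sub_eq_add_neg] using hminus)
  have hlt : ∀ᶠ s in 𝓝[>] (0 : ℝ), s < 1 := nhdsWithin_le_nhds (Iio_mem_nhds zero_lt_one)
  obtain ⟨s, ⟨⟨h₁, h₂⟩, ⟨h₃, h₄⟩, hs1⟩, hs0⟩ :=
    (((key h hsum hnorm hplus).and (key₂.and hlt)).and self_mem_nhdsWithin).exists
  replace hs0 : 0 < s := hs0
  have hy : q + (s / 2) • (p - q) = (s / 2) • p + (1 - s / 2) • q := by module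
  -- The shifted ends average to `p + (1 - s) • (q - p)`, while `y = p + (1 - s / 2) • (q - p)`.
  -- Crossing the two factors gives `A = 1 - s / 2` and `B = 1 - s`.
  refine ⟨_, h₁, _, h₃, (s / 2) • p + (1 - s / 2) • q,
    convex_stdSimplex ℝ Ω hp hqmem (by linarith) (by linarith) (by ring), 1 - s / 2, 1 - s,
    by linarith, by linarith, by linarith, h₂, h₄, ?_, ?_⟩
  · have hne : T p ≠ T q := fun he => by rw [he, htc] at hpc; exact lt_irrefl _ hpc
    have := hvq.comp_lt hp hqmem hne (a := s / 2) (b := 1 - s / 2) (by linarith) (by linarith)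
      (by ring)
    rwa [htc, max_eq_right hpc.le] at this
  · module

end Geometry

/-! ### The three values as optimization over moments -/

section Values

variable {Ω : Type*} [Fintype Ω] {VV : Belief Ω → Set ℝ} {W : Belief Ω → ℝ} {p : Belief Ω}

theorem isSelection_iff_eq (hW : Continuous W) (hV : ∀ μ, VV μ = {W μ}) {U : Belief Ω → ℝ} :
    IsSelection VV U ↔ U = W := by
  constructor
  · rintro ⟨-, h⟩
    funext μ
    simpa [hV] using h μ
  · rintro rfl
    exact ⟨hW.measurable, fun μ => by simp [hV]⟩

theorem bayesPlausible_iff {τ : ProbabilityMeasure (Belief Ω)} :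
    BayesPlausible p τ ↔ (moments W p τ).1 = p.1 :=
  funext_iff.symm

theorem truthTelling_iff {τ : ProbabilityMeasure (Belief Ω)} :
    TruthTelling p W τ ↔ (moments W p τ).2.1 = 0 :=
  funext_iff.symm

/-- A constant value factors out of the covariance, which therefore vanishes once the mean is `p`.
-/
theorem moments_of_ae_eq {τ : ProbabilityMeasure (Belief Ω)} {c : ℝ}
    (hτ : ∀ᵐ μ ∂(τ : Measure (Belief Ω)), W μ = c) :
    moments W p τ = ((moments W p τ).1, c • ((moments W p τ).1 - p.1), c) := by
  refine Prod.ext rfl (Prod.ext (funext fun ω => ?_) ?_)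
  · have : (fun μ : Belief Ω => W μ * (μ.1 ω - p.1 ω)) =ᵐ[(τ : Measure (Belief Ω))]
        fun μ => c * (μ.1 ω - p.1 ω) := by
      filter_upwards [hτ] with μ hμ
      rw [hμ]
    simp only [moments, Pi.smul_apply, Pi.sub_apply, smul_eq_mul]
    rw [integral_congr_ae this, integral_const_mul,
      integral_sub (integrable_of_continuous (continuous_belief_apply ω) τ)
        (integrable_const _)]
    simp
  · simp only [moments]
    rw [integral_congr_ae hτ]
    simp

theorem valueBP_eq (hV : ∀ μ, VV μ = {W μ}) :
    valueBP VV p = sSup {s | ∃ z, (p.1, z, s) ∈ range (moments W p)} := by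
  unfold valueBP
  congr 1
  ext s
  simp only [hV, csSup_singleton]
  constructor
  · rintro ⟨τ, hτ, rfl⟩
    exact ⟨(moments W p τ).2.1, τ, Prod.ext (bayesPlausible_iff.1 hτ) rfl⟩
  · rintro ⟨z, τ, hτ⟩
    exact ⟨τ, (bayesPlausible_iff (W := W)).2 (by rw [hτ]), by
      simpa [moments] using (congrArg (fun x => x.2.2) hτ).symm⟩

theorem valueMD_eq (hW : Continuous W) (hV : ∀ μ, VV μ = {W μ}) :
    valueMD VV p = sSup {s | (p.1, 0, s) ∈ range (moments W p)} := by
  unfold valueMD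
  congr 1
  ext s
  simp only [isSelection_iff_eq hW hV]
  constructor
  · rintro ⟨U, τ, rfl, hτ, htt, rfl⟩
    exact ⟨τ, Prod.ext (bayesPlausible_iff.1 hτ) (Prod.ext (truthTelling_iff.1 htt) rfl)⟩
  · rintro ⟨τ, hτ⟩
    exact ⟨W, τ, rfl, (bayesPlausible_iff (W := W)).2 (by rw [hτ]),
      truthTelling_iff.2 (by rw [hτ]),
      by simpa [moments] using (congrArg (fun x => x.2.2) hτ).symm⟩

theorem isCompact_valuesBP (hW : Continuous W) :
    IsCompact {s | ∃ z, (p.1, z, s) ∈ range (moments W p)} := by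
  have h := ((isCompact_range_moments hW p).inter_right
    (isClosed_eq continuous_fst continuous_const :
      IsClosed {x : (Ω → ℝ) × (Ω → ℝ) × ℝ | x.1 = p.1})).image
    (continuous_snd.comp continuous_snd)
  convert h using 1
  ext s
  constructor
  · rintro ⟨z, hz⟩
    exact ⟨_, ⟨hz, rfl⟩, rfl⟩
  · rintro ⟨⟨x, z, s⟩, ⟨hx, rfl⟩, rfl⟩
    exact ⟨z, hx⟩

theorem isCompact_valuesMD (hW : Continuous W) :
    IsCompact {s | (p.1, 0, s) ∈ range (moments W p)} := by
  have h := ((isCompact_range_moments hW p).inter_right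
    (isClosed_eq (by fun_prop) continuous_const :
      IsClosed {x : (Ω → ℝ) × (Ω → ℝ) × ℝ | (x.1, x.2.1) = (p.1, 0)})).image
    (continuous_snd.comp continuous_snd)
  convert h using 1
  ext s
  constructor
  · intro hz
    exact ⟨_, ⟨hz, rfl⟩, rfl⟩
  · rintro ⟨⟨x, z, s⟩, ⟨hx, hxz⟩, rfl⟩
    simp only [mem_ofPred_eq, Prod.mk.injEq] at hxz
    rw [← hxz.1, ← hxz.2]
    exact hx

/-- Continuity upgrades almost sure constancy to constancy on the support; `M` bounds the set whose
supremum is taken. -/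
theorem le_valueCT (hW : Continuous W) (hV : ∀ μ, VV μ = {W μ}) {M : ℝ} (hM : ∀ μ, W μ ≤ M)
    {τ : ProbabilityMeasure (Belief Ω)} (hτ : BayesPlausible p τ) {s : ℝ}
    (hs : ∀ᵐ μ ∂(τ : Measure (Belief Ω)), W μ = s) : s ≤ valueCT VV p := by
  refine le_csSup ⟨M, ?_⟩ ⟨W, τ, (isSelection_iff_eq hW hV).2 rfl, hτ, ⟨s, eqOn_supp_of_ae hW hs⟩,
    ?_⟩
  · rintro _ ⟨U, τ, hU, -, -, rfl⟩
    rw [(isSelection_iff_eq hW hV).1 hU]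
    refine (integral_mono (integrable_of_continuous hW τ) (integrable_const M) hM).trans ?_
    simp
  · rw [integral_congr_ae hs]
    simp

theorem ae_eq_of_integral_eq (hW : Continuous W) {M : ℝ} (hM : ∀ μ, W μ ≤ M)
    {τ : ProbabilityMeasure (Belief Ω)} (h : ∫ μ, W μ ∂(τ : Measure (Belief Ω)) = M) :
    ∀ᵐ μ ∂(τ : Measure (Belief Ω)), W μ = M := by
  have hi := integrable_of_continuous hW τ
  have h0 : ∫ μ, (M - W μ) ∂(τ : Measure (Belief Ω)) = 0 := by
    rw [integral_sub (integrable_const M) hi, h]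
    simp
  filter_upwards [(integral_eq_zero_iff_of_nonneg (fun μ => sub_nonneg.2 (hM μ))
    ((integrable_const M).sub hi)).1 h0] with μ hμ
  exact (sub_eq_zero.1 hμ).symm

/-- If the value is not almost surely constant under a mediation policy `τ`, then Bayesian
persuasion improves on `τ` by giving more weight to posteriors with a higher value. -/
theorem exists_improvement (hW : Continuous W)
    {τ : ProbabilityMeasure (Belief Ω)} {t : ℝ} (hτ : moments W p τ = (p.1, 0, t))
    (hne : ¬ ∀ᵐ μ ∂(τ : Measure (Belief Ω)), W μ = t) :
    ∃ s > t, ∃ z, (p.1, z, s) ∈ range (moments W p) := by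
  have hbp : ∀ ω, ∫ μ, μ.1 ω ∂(τ : Measure (Belief Ω)) = p.1 ω := fun ω =>
    congrFun (congrArg Prod.fst hτ) ω
  have htt : ∀ ω, ∫ μ, W μ * (μ.1 ω - p.1 ω) ∂(τ : Measure (Belief Ω)) = 0 := fun ω =>
    congrFun (congrArg (fun x => x.2.1) hτ) ω
  have hval : ∫ μ, W μ ∂(τ : Measure (Belief Ω)) = t := congrArg (fun x => x.2.2) hτ
  obtain ⟨x, -, hx⟩ := isCompact_univ.exists_isMinOn ⟨p, mem_univ _⟩ hW.continuousOn
  have hmin : ∀ μ, W x ≤ W μ := fun μ => hx (mem_univ μ)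
  set R : ℝ := |t - W x| with hR
  -- Makes the density `1 + e * (W - t)` nonnegative, as `t - W ≤ R`.
  set e : ℝ := 1 / (R + 1) with he
  have he0 : 0 < e := by positivity
  have heR : e * R ≤ 1 := by
    rw [he, div_mul_eq_mul_div, one_mul, div_le_one (by positivity)]; linarith
  have hgc : Continuous fun μ => 1 + e * (W μ - t) := by fun_prop
  have hg0 : ∀ μ, 0 ≤ 1 + e * (W μ - t) := fun μ => by
    have : t - W μ ≤ R := (sub_le_sub_left (hmin μ) t).trans (le_abs_self _)
    nlinarith
  have hgf : ∀ f : Belief Ω → ℝ, Continuous f →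
      ∫ μ, (1 + e * (W μ - t)) * f μ ∂(τ : Measure (Belief Ω)) =
        ∫ μ, f μ ∂(τ : Measure (Belief Ω)) +
          e * ∫ μ, (W μ - t) * f μ ∂(τ : Measure (Belief Ω)) := fun f hf => by
    rw [← integral_const_mul, ← integral_add (integrable_of_continuous hf τ)
      (integrable_of_continuous (by fun_prop) τ)]
    exact integral_congr_ae (ae_of_all _ fun μ => by ring)
  have hWt0 : ∫ μ, (W μ - t) ∂(τ : Measure (Belief Ω)) = 0 := by
    rw [integral_sub (integrable_of_continuous hW τ) (integrable_const t), hval]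
    simp
  obtain ⟨τ', -, hτ'⟩ := exists_reweighting τ hgc.measurable hg0 (integrable_of_continuous hgc τ)
    (by
      have := hgf (fun _ => 1) continuous_const
      simp only [mul_one, hWt0] at this
      rw [this]
      simp)
  have hbp' : (moments W p τ').1 = p.1 := funext fun ω => by
    simp only [moments]
    rw [hτ', hgf _ (continuous_belief_apply ω), hbp]
    -- Truth-telling is what keeps the mean posterior at `p` under the new weights.
    have : ∫ μ, (W μ - t) * μ.1 ω ∂(τ : Measure (Belief Ω)) = 0 := by
      have hsplit : ∀ μ : Belief Ω, (W μ - t) * μ.1 ω =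
          W μ * (μ.1 ω - p.1 ω) + (W μ * p.1 ω - t * μ.1 ω) := fun μ => by ring
      have hω := continuous_belief_apply (Ω := Ω) ω
      simp only [hsplit]
      have i₁ : Integrable (fun μ : Belief Ω => W μ * p.1 ω) (τ : Measure (Belief Ω)) :=
        integrable_of_continuous (hW.mul continuous_const) τ
      have i₂ : Integrable (fun μ : Belief Ω => t * μ.1 ω) (τ : Measure (Belief Ω)) :=
        integrable_of_continuous (continuous_const.mul hω) τ
      have i₃ : Integrable (fun μ : Belief Ω => W μ * p.1 ω - t * μ.1 ω)
        (τ : Measure (Belief Ω)) := i₁.sub i₂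
      rw [integral_add (integrable_of_continuous (continuous_covariance_term hW p ω) τ) i₃,
        integral_sub i₁ i₂,
        integral_mul_const, integral_const_mul, htt, hval, hbp]
      ring
    rw [this, mul_zero, add_zero]
  refine ⟨(moments W p τ').2.2, ?_, (moments W p τ').2.1, τ', Prod.ext hbp' rfl⟩
  simp only [moments]
  rw [hτ', hgf _ hW, hval]
  have hsq : ∫ μ, (W μ - t) * W μ ∂(τ : Measure (Belief Ω)) =
      ∫ μ, (W μ - t) ^ 2 ∂(τ : Measure (Belief Ω)) := by
    have hsplit : ∀ μ : Belief Ω, (W μ - t) * W μ = (W μ - t) ^ 2 + t * (W μ - t) :=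
      fun μ => by ring
    simp only [hsplit]
    rw [integral_add (integrable_of_continuous (by fun_prop) τ)
      (integrable_of_continuous (by fun_prop) τ), integral_const_mul, hWt0, mul_zero, add_zero]
  rw [hsq, gt_iff_lt, lt_add_iff_pos_right]
  refine mul_pos he0 (lt_of_le_of_ne (integral_nonneg fun μ => sq_nonneg _) fun h0 => hne ?_)
  filter_upwards [(integral_eq_zero_iff_of_nonneg (fun μ => sq_nonneg (W μ - t))
    (integrable_of_continuous (by fun_prop) τ)).1 h0.symm] with μ hμ
  exact sub_eq_zero.1 (pow_eq_zero_iff two_ne_zero |>.1 hμ)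

end Values

/-! ### Consequences of full dimensionality -/

section FullDimensional

variable {Ω : Type*} [Fintype Ω] {VV : Belief Ω → Set ℝ} {W : Belief Ω → ℝ} {p : Belief Ω}

/-- Under full dimensionality, `p` can be written as a mixture of any posterior `q` and posteriors
that attain the optimal cheap talk value. -/
theorem FullDimensional.exists_split (hfull : FullDimensional VV p) (hV : ∀ μ, VV μ = {W μ})
    (q : Belief Ω) :
    ∃ ε : ℝ, 0 < ε ∧ ε < 1 ∧ ∃ τ : ProbabilityMeasure (Belief Ω),
      (∀ᵐ μ ∂(τ : Measure (Belief Ω)), W μ = valueCT VV p) ∧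
      ∀ ω, p.1 ω = ε * q.1 ω + (1 - ε) * ∫ μ, μ.1 ω ∂(τ : Measure (Belief Ω)) := by
  have hq : q.1 ∈ cheapTalkHull VV p (valueCT VV p) := by
    rw [hfull]; exact q.2
  simp only [cheapTalkHull, mem_iUnion, mem_inter_iff] at hq
  obtain ⟨τ, ⟨⟨hbp, -⟩, hs, hfin⟩, hqτ, -⟩ := hq
  obtain ⟨ε, h0, h1, τ', hac, hτ'⟩ := exists_split_of_mem_affineSpan hfin hbp hqτ
  refine ⟨ε, h0, h1, τ', hac.ae_le ?_, hτ'⟩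
  filter_upwards [ae_mem_supp τ] with μ hμ
  have := hs μ hμ
  rw [hV] at this
  exact this.symm

/-- Splitting off `q = p` leaves the mean at `p`, so the cheap talk value is attained. -/
theorem FullDimensional.moments_cheapTalk (hfull : FullDimensional VV p)
    (hV : ∀ μ, VV μ = {W μ}) : (p.1, 0, valueCT VV p) ∈ range (moments W p) := by
  obtain ⟨ε, -, h1, τ, hτ, h⟩ := hfull.exists_split hV p
  have hbp : (moments W p τ).1 = p.1 := funext fun ω => by
    have : (1 - ε) * ((moments W p τ).1 ω - p.1 ω) = 0 := by
      simp only [moments]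
      linarith [h ω]
    exact sub_eq_zero.1 ((mul_eq_zero.1 this).resolve_left (by linarith))
  refine ⟨τ, ?_⟩
  rw [moments_of_ae_eq hτ, hbp, sub_self, smul_zero]

/-- In the mixture with the Dirac mass at `q`, the remaining posteriors have value `c` and mean
deviation offsetting `ε • (q - p)`; they add `-c * ε * (q - p)` to the covariance. -/
theorem FullDimensional.exists_moments (hW : Continuous W) (hfull : FullDimensional VV p)
    (hV : ∀ μ, VV μ = {W μ}) (q : Belief Ω) :
    ∃ ε : ℝ, 0 < ε ∧ (p.1, ε • (W q - valueCT VV p) • (q.1 - p.1),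
      valueCT VV p + ε * (W q - valueCT VV p)) ∈ range (moments W p) := by
  obtain ⟨ε, h0, h1, τ, hτ, h⟩ := hfull.exists_split hV q
  set c := valueCT VV p
  refine ⟨ε, h0, ?_⟩
  have hmix := convex_range_moments hW p (moments_mem_range W p q) ⟨τ, rfl⟩ h0.le
    (sub_nonneg.2 h1.le) (by ring)
  convert hmix using 1
  refine Prod.ext (funext fun ω => ?_) (Prod.ext (funext fun ω => ?_) ?_)
  · simpa [moments] using h ω
  · rw [moments_of_ae_eq hτ]
    simp only [moments, Prod.snd_add, Prod.fst_add, Prod.smul_snd, Prod.smul_fst, Pi.add_apply,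
      Pi.smul_apply, Pi.sub_apply, smul_eq_mul]
    linear_combination c * h ω
  · rw [moments_of_ae_eq hτ]
    simp only [Prod.snd_add, Prod.smul_snd, smul_eq_mul]
    ring

theorem integral_mem_of_convex {S : Set (Ω → ℝ)} (hS : Convex ℝ S) (hSc : IsClosed S)
    {τ : ProbabilityMeasure (Belief Ω)} (h : ∀ᵐ μ ∂(τ : Measure (Belief Ω)), μ.1 ∈ S) :
    (fun ω => ∫ μ, μ.1 ω ∂(τ : Measure (Belief Ω))) ∈ S := by
  have hi : ∀ ω, Integrable (fun μ : Belief Ω => μ.1 ω) (τ : Measure (Belief Ω)) := fun ω =>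
    integrable_of_continuous (continuous_belief_apply ω) τ
  have := hS.integral_mem hSc h (Integrable.of_eval hi)
  convert this using 1
  funext ω
  exact (eval_integral hi ω).symm

end FullDimensional

/-! ### Feasible directions and the strict ranking -/

section MediationGain

variable {Ω : Type*} [Fintype Ω] {k : ℕ} {VV : Belief Ω → Set ℝ} {p : Belief Ω}

/-- The directions in which mean value and covariance can be moved away from the moments
`(p, 0, c)`. -/
def feasibleDirections (W : Belief Ω → ℝ) (p : Belief Ω) (c : ℝ) : Set ((Ω → ℝ) × ℝ) :=
  {x | ∃ ε : ℝ, 0 < ε ∧ (p.1, ε • x.1, c + ε * x.2) ∈ range (moments W p)}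

theorem add_mem_feasibleDirections {W : Belief Ω → ℝ} (hW : Continuous W) {c : ℝ}
    {x y : (Ω → ℝ) × ℝ} (hx : x ∈ feasibleDirections W p c) (hy : y ∈ feasibleDirections W p c) :
    x + y ∈ feasibleDirections W p c := by
  obtain ⟨a, ha, hxa⟩ := hx
  obtain ⟨b, hb, hyb⟩ := hy
  have hab : a + b ≠ 0 := (add_pos ha hb).ne'
  -- Crossed weights `b / (a + b)` and `a / (a + b)` give both directions this common step size.
  refine ⟨a * b / (a + b), by positivity, ?_⟩
  have h := convex_range_moments hW p hxa hyb (a := b / (a + b)) (b := a / (a + b))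
    (by positivity) (by positivity) (by field_simp; ring)
  convert h using 1
  refine Prod.ext (funext fun ω => ?_) (Prod.ext (funext fun ω => ?_) ?_)
  · simp only [Prod.fst_add, Prod.smul_fst, Pi.add_apply, Pi.smul_apply, smul_eq_mul]
    field_simp
    ring
  · simp only [Prod.snd_add, Prod.fst_add, Prod.smul_snd, Prod.smul_fst, Pi.add_apply,
      Pi.smul_apply, smul_eq_mul]
    field_simp
  · simp only [Prod.snd_add, Prod.smul_snd, smul_eq_mul]
    field_simp
    ring

theorem smul_mem_feasibleDirections {W : Belief Ω → ℝ} {c : ℝ} {x : (Ω → ℝ) × ℝ} {a : ℝ}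
    (ha : 0 < a) (hx : x ∈ feasibleDirections W p c) : a • x ∈ feasibleDirections W p c := by
  obtain ⟨ε, hε, h⟩ := hx
  refine ⟨ε / a, by positivity, ?_⟩
  simpa [smul_smul, div_mul_cancel₀ ε ha.ne', ← mul_assoc] using h

variable {T : (Ω → ℝ) →ₗ[ℝ] (Fin k → ℝ)} {v : (Fin k → ℝ) → ℝ}

theorem continuous_value (hvc : ContinuousOn v (relevantMoments T)) :
    Continuous fun μ : Belief Ω => v (T μ.1) :=
  (continuousOn_comp_moment hvc).comp_continuous continuous_subtype_val fun μ => μ.2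

/-- The optimal cheap talk value is strictly above the value of no disclosure. -/
theorem lt_valueCT (hk : 2 ≤ k) (hT : IsMoment T) (hvc : ContinuousOn v (relevantMoments T))
    (hvq : StrictQuasiconvexOn (relevantMoments T) v) (hp : ∀ ω, 0 < p.1 ω)
    (hV : ∀ μ, VV μ = {v (T μ.1)}) (hfull : FullDimensional VV p) :
    v (T p.1) < valueCT VV p := by
  set c := valueCT VV p
  have hclosed : IsClosed {x ∈ stdSimplex ℝ Ω | v (T x) ≤ c} :=
    (continuousOn_comp_moment hvc).preimage_isClosed_of_isClosed (isClosed_stdSimplex ℝ Ω)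
      isClosed_Iic
  have split : ∀ q : Belief Ω, ∃ ε : ℝ, 0 < ε ∧ ε < 1 ∧ ∃ r ∈ stdSimplex ℝ Ω, v (T r) ≤ c ∧
      p.1 = ε • q.1 + (1 - ε) • r := fun q => by
    obtain ⟨ε, h0, h1, τ, hτ, h⟩ := hfull.exists_split hV q
    have := integral_mem_of_convex (hvq.convex_sublevel c) hclosed
      (hτ.mono fun μ hμ => ⟨μ.2, hμ.le⟩)
    exact ⟨ε, h0, h1, _, this.1, this.2, funext h⟩
  obtain ⟨m, hm, hmT⟩ := exists_moment_notMem_span hk hT (T p.1) 0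
  have hne : T (m - p.1) ≠ 0 := fun h => hmT (by rw [← map_sub, h]; exact zero_mem _)
  obtain ⟨δ, hδ, hball⟩ := exists_radius p.2 hp
  set t : ℝ := δ / (‖m - p.1‖ + 1) with ht
  have ht0 : 0 < t := by positivity
  -- Full support of `p` lets the line from `m` continue beyond `p`; splitting off either end leaves
  -- a residual mean on the other side.
  have hopp : p.1 + (-t) • (m - p.1) ∈ stdSimplex ℝ Ω := by
    refine hball _ ?_ ?_
    · simp [← Finset.mul_sum, hm.2, p.2.2]
    · rw [norm_smul, norm_neg, Real.norm_of_nonneg ht0.le, ht, div_mul_eq_mul_div,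
        div_le_iff₀ (by positivity)]
      exact mul_le_mul_of_nonneg_left (by linarith) hδ.le
  obtain ⟨ε₁, h₁, h₁', r₁, hr₁, hc₁, he₁⟩ := split ⟨m, hm⟩
  obtain ⟨ε₂, h₂, h₂', r₂, hr₂, hc₂, he₂⟩ := split ⟨_, hopp⟩
  simp only at he₁ he₂
  set s₁ : ℝ := ε₁ / (1 - ε₁) with hs₁
  set s₂ : ℝ := ε₂ * t / (1 - ε₂) with hs₂
  have hs₁0 : 0 < s₁ := div_pos h₁ (by linarith)
  have hs₂0 : 0 < s₂ := div_pos (mul_pos h₂ ht0) (by linarith)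
  have hr₁e : r₁ = p.1 - s₁ • (m - p.1) := by
    have : (1 - ε₁) • r₁ = (1 - ε₁) • (p.1 - s₁ • (m - p.1)) := by
      rw [smul_sub, smul_smul, hs₁, mul_div_cancel₀ _ (by linarith : (1 - ε₁) ≠ 0),
        eq_sub_of_add_eq' he₁.symm]
      module
    exact smul_right_injective _ (by linarith : (1 - ε₁) ≠ 0) this
  have hr₂e : r₂ = p.1 + s₂ • (m - p.1) := by
    have : (1 - ε₂) • r₂ = (1 - ε₂) • (p.1 + s₂ • (m - p.1)) := by
      rw [smul_add, smul_smul, hs₂, mul_div_cancel₀ _ (by linarith : (1 - ε₂) ≠ 0),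
        eq_sub_of_add_eq' he₂.symm]
      module
    exact smul_right_injective _ (by linarith : (1 - ε₂) ≠ 0) this
  have hTne : T r₁ ≠ T r₂ := fun h => by
    rw [hr₁e, hr₂e, map_sub, map_add, map_smul, map_smul, sub_eq_add_neg, add_right_inj,
      neg_eq_iff_add_eq_zero, ← add_smul, smul_eq_zero] at h
    exact hne (h.resolve_left (by positivity))
  have hlt := hvq.comp_lt hr₁ hr₂ hTne (a := s₂ / (s₁ + s₂)) (b := s₁ / (s₁ + s₂))
    (by positivity) (by positivity) (by field_simp; ring)
  have hpe : (s₂ / (s₁ + s₂)) • r₁ + (s₁ / (s₁ + s₂)) • r₂ = p.1 := by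
    rw [hr₁e, hr₂e]
    funext ω
    simp only [Pi.add_apply, Pi.sub_apply, Pi.smul_apply, smul_eq_mul]
    field_simp
    ring
  rw [hpe] at hlt
  exact hlt.trans_le (max_le hc₁ hc₂)

/-- If some posterior has a value above the optimal cheap talk value, mediation strictly improves
on cheap talk. -/
theorem exists_mediation_gain (hk : 2 ≤ k) (hT : IsMoment T)
    (hvc : ContinuousOn v (relevantMoments T)) (hvq : StrictQuasiconvexOn (relevantMoments T) v)
    (hp : ∀ ω, 0 < p.1 ω) (hV : ∀ μ, VV μ = {v (T μ.1)}) (hfull : FullDimensional VV p)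
    {m : Belief Ω} (hm : valueCT VV p < v (T m.1)) :
    ∃ s > valueCT VV p, (p.1, 0, s) ∈ range (moments (fun μ => v (T μ.1)) p) := by
  have hpc := lt_valueCT hk hT hvc hvq hp hV hfull
  have hW := continuous_value (Ω := Ω) hvc
  obtain ⟨x₁, hx₁, x₂, hx₂, y, hy, A, B, hA, hB, hBA, h₁, h₂, h₃, heq⟩ :=
    exists_profitable_deviation hk hT hvc hvq p.2 hp m.2 hpc hm
  set c := valueCT VV p
  have hdir : ∀ q : Belief Ω, ((v (T q.1) - c) • (q.1 - p.1), v (T q.1) - c) ∈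
      feasibleDirections (fun μ => v (T μ.1)) p c := fun q => hfull.exists_moments hW hV q
  -- Dividing by the distance of each value from `c` turns the contributions into `A / 2`, `A / 2`
  -- and `-B` times `(x - p, 1)`, with `x` the respective point; all three weights are positive
  -- because `y` lies below `c`.
  have hsum := add_mem_feasibleDirections hW
    (add_mem_feasibleDirections hW
      (smul_mem_feasibleDirections (a := A / 2 / (v (T x₁) - c))
        (div_pos (by linarith) (by linarith)) (hdir ⟨x₁, hx₁⟩))
      (smul_mem_feasibleDirections (a := A / 2 / (v (T x₂) - c))
        (div_pos (by linarith) (by linarith)) (hdir ⟨x₂, hx₂⟩)))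
    (smul_mem_feasibleDirections (a := B / (c - v (T y)))
      (div_pos (by linarith) (by linarith)) (hdir ⟨y, hy⟩))
  have e₁ : A / 2 / (v (T x₁) - c) * (v (T x₁) - c) = A / 2 :=
    div_mul_cancel₀ _ (by linarith)
  have e₂ : A / 2 / (v (T x₂) - c) * (v (T x₂) - c) = A / 2 :=
    div_mul_cancel₀ _ (by linarith)
  have e₃ : B / (c - v (T y)) * (v (T y) - c) = -B := by
    rw [← neg_sub c, mul_neg, div_mul_cancel₀ _ (by linarith)]
  simp only [Prod.smul_mk, Prod.mk_add_mk, smul_smul, smul_eq_mul, e₁, e₂, e₃, heq] at hsum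
  obtain ⟨ε, hε, h⟩ := hsum
  refine ⟨c + ε * (A - B), ?_, ?_⟩
  · have := mul_pos hε (sub_pos.2 hBA)
    linarith
  · convert h using 3
    · simp
    · ring

/-- If some posterior has a value above the optimal cheap talk value, then cheap talk, mediation,
persuasion and the maximal value are strictly ranked; otherwise all of them coincide. -/
theorem FullDimensional.value_dichotomy (hk : 2 ≤ k) (hT : IsMoment T)
    (hvc : ContinuousOn v (relevantMoments T)) (hvq : StrictQuasiconvexOn (relevantMoments T) v)
    (hp : ∀ ω, 0 < p.1 ω) (hV : ∀ μ, VV μ = {v (T μ.1)}) (hfull : FullDimensional VV p) :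
    ∃ M : ℝ, IsGreatest (range fun μ : Belief Ω => v (T μ.1)) M ∧
      Xor (M = valueBP VV p ∧ valueBP VV p = valueMD VV p ∧ valueMD VV p = valueCT VV p ∧
          valueCT VV p > v (T p.1))
        (M > valueBP VV p ∧ valueBP VV p > valueMD VV p ∧ valueMD VV p > valueCT VV p ∧
          valueCT VV p > v (T p.1)) := by
  have hW := continuous_value (Ω := Ω) hvc
  have hgt := lt_valueCT hk hT hvc hvq hp hV hfull
  obtain ⟨m, -, hm⟩ := isCompact_univ.exists_isMaxOn ⟨p, mem_univ p⟩ hW.continuousOn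
  have hM : ∀ μ : Belief Ω, v (T μ.1) ≤ v (T m.1) := fun μ => hm (mem_univ μ)
  have hK : ∀ {x z s}, (x, z, s) ∈ range (moments (fun μ : Belief Ω => v (T μ.1)) p) →
      s ≤ v (T m.1) := by
    rintro x z s ⟨τ, hτ⟩
    obtain rfl : _ = s := congrArg (fun x => x.2.2) hτ
    refine (integral_mono (integrable_of_continuous hW τ)
      (integrable_const _) hM).trans ?_
    simp
  have hctmd := hfull.moments_cheapTalk hV
  refine ⟨v (T m.1), ⟨⟨m, rfl⟩, forall_mem_range.2 hM⟩, ?_⟩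
  have hMD := (isCompact_valuesMD (p := p) hW).isGreatest_sSup ⟨_, hctmd⟩
  have hBP := (isCompact_valuesBP (p := p) hW).isGreatest_sSup ⟨_, _, hctmd⟩
  rw [← valueMD_eq hW hV] at hMD
  rw [← valueBP_eq hV] at hBP
  have hct_le : valueCT VV p ≤ valueMD VV p := hMD.2 hctmd
  have hmd_le : valueMD VV p ≤ valueBP VV p :=
    hBP.2 ⟨_, hMD.1⟩
  have hbp_le : valueBP VV p ≤ v (T m.1) := by
    obtain ⟨z, hz⟩ := hBP.1
    exact hK hz
  rcases (hct_le.trans (hmd_le.trans hbp_le)).eq_or_lt with heq | hlt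
  · refine Or.inl ⟨⟨by linarith, by linarith, by linarith, hgt⟩, fun h => ?_⟩
    linarith [h.1]
  · obtain ⟨s, hs, hsmd⟩ := exists_mediation_gain hk hT hvc hvq hp hV hfull hlt
    have hct_lt : valueCT VV p < valueMD VV p :=
      lt_of_lt_of_le hs (hMD.2 hsmd)
    have hmd_lt : valueMD VV p < valueBP VV p := by
      obtain ⟨τ, hτ⟩ := hMD.1
      -- An almost surely constant value would make the mediation optimum attainable by cheap talk.
      obtain ⟨s, hs, hsbp⟩ := exists_improvement hW hτ fun hae =>
        hct_lt.not_ge (le_valueCT hW hV hM (bayesPlausible_iff.2 (by rw [hτ])) hae)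
      exact lt_of_lt_of_le hs (hBP.2 hsbp)
    have hbp_lt : valueBP VV p < v (T m.1) := by
      refine lt_of_le_of_ne hbp_le fun he => hlt.not_ge ?_
      obtain ⟨z, τ, hτ⟩ := hBP.1
      rw [he] at hτ
      exact le_valueCT hW hV hM ((bayesPlausible_iff (W := fun μ => v (T μ.1))).2 (by rw [hτ]))
        (ae_eq_of_integral_eq hW hM (congrArg (fun x => x.2.2) hτ))
    exact Or.inr ⟨⟨hbp_lt, hmd_lt, hct_lt, hgt⟩, fun h => hbp_lt.ne' h.1⟩

end MediationGain

end Mediation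

end

theorem theorem4 {Ω A : Type*} [Fintype Ω] [MetricSpace A] [CompactSpace A]
    (uS : A → ℝ) (huS : Continuous uS) (uR : Ω → A → ℝ) (huR : ∀ ω, Continuous (uR ω))
    (p : Mediation.Belief Ω) (hp : ∀ ω, 0 < p.1 ω)
    {k : ℕ} (hk : 2 ≤ k) (T : (Ω → ℝ) →ₗ[ℝ] (Fin k → ℝ)) (hT : Mediation.IsMoment T)
    (v : (Fin k → ℝ) → ℝ) (hvc : ContinuousOn v (Mediation.relevantMoments T))
    (hvq : Mediation.StrictQuasiconvexOn (Mediation.relevantMoments T) v)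
    (hV : ∀ μ : Mediation.Belief Ω, Mediation.indirectValue uS uR μ = {v (T μ.1)})
    (hfull : Mediation.FullDimensional (Mediation.indirectValue uS uR) p) :
    ∃ M : ℝ, IsGreatest (Set.range fun μ : Mediation.Belief Ω => v (T μ.1)) M ∧
      Xor
        (M = Mediation.valueBP (Mediation.indirectValue uS uR) p ∧
          Mediation.valueBP (Mediation.indirectValue uS uR) p =
            Mediation.valueMD (Mediation.indirectValue uS uR) p ∧
          Mediation.valueMD (Mediation.indirectValue uS uR) p =
            Mediation.valueCT (Mediation.indirectValue uS uR) p ∧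
          Mediation.valueCT (Mediation.indirectValue uS uR) p > v (T p.1))
        (M > Mediation.valueBP (Mediation.indirectValue uS uR) p ∧
          Mediation.valueBP (Mediation.indirectValue uS uR) p >
            Mediation.valueMD (Mediation.indirectValue uS uR) p ∧
          Mediation.valueMD (Mediation.indirectValue uS uR) p >
            Mediation.valueCT (Mediation.indirectValue uS uR) p ∧
          Mediation.valueCT (Mediation.indirectValue uS uR) p > v (T p.1)) :=
  Mediation.FullDimensional.value_dichotomy hk hT hvc hvq hp hV hfull
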